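/- Let $G$ be a discrete group and let $N\trianglelefteq G$ be a normal subgroup which is torsion-free, maximal abelian (that is, $N$ is abelian and is not properly contained in any abelian subgroup of $G$), and such that $D:=G/N$ is finite (so that $G$ is virtually abelian). Let $C^*(G)$ be the full group $C^*$-algebra of $G$, that is, the completion of $\mathbb{C}[G]$ in the norm $\|f\|=\sup_\pi\|\sum_{g}f(g)\pi(g)\|$, where $\pi$ runs over the unitary representations of $G$ on Hilbert spaces. Let $\widehat N=\operatorname{Hom}(N,\mathbb{T})$ be the Pontryagin dual of the discrete group $N$, with the topology of pointwise convergence, on which $D$ acts by $(gN\cdot\chi)(a)=\chi(g^{-1}ag)$ for $g\in G$, $\chi\in\widehat N$, $a\in N$. Then the centre of $C^*(G)$ is $*$-isomorphic to the $C^*$-algebra $C(\widehat N/D)$ of continuous complex-valued functions on the orbit space $\widehat N/D$ with the quotient topology. -/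

import Mathlib

open scoped ENNReal

universe u

noncomputable section

/-- A unitary representation of the (discrete) group `G` on a nonzero complex Hilbert space. The
Hilbert spaces live in the universe of `G`; this is no restriction on the norms below, since every
cyclic representation of `G` acts on a Hilbert space with a dense subspace spanned by `G`. -/
structure UnitaryRep (G : Type u) [Group G] where
  /-- the underlying Hilbert space -/
  space : Type u
  [normed : NormedAddCommGroup space]
  [innerProduct : InnerProductSpace ℂ space]
  [complete : CompleteSpace space]
  [nontrivial : Nontrivial space]
  /-- the homomorphism to the unitary group -/
  hom : G →* unitary (space →L[ℂ] space)

namespace UnitaryRep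

attribute [instance] normed innerProduct complete nontrivial

end UnitaryRep

/-- The C⋆-algebra of all bounded families `(T_π)` of operators, `π` running through the unitary
representations of `G`, with `‖T‖ = sup_π ‖T_π‖`. -/
abbrev UniversalProduct (G : Type u) [Group G] : Type (u + 1) :=
  lp (fun π : UnitaryRep G => π.space →L[ℂ] π.space) ∞

instance (G : Type u) [Group G] : CStarAlgebra (UniversalProduct G) where

/-- The universal unitary representation `g ↦ (π g)_π`. -/
def universalRep (G : Type u) [Group G] (g : G) : UniversalProduct G :=
  ⟨fun π => (π.hom g : π.space →L[ℂ] π.space), memℓp_infty ⟨1, by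
    rintro _ ⟨π, rfl⟩
    exact (CStarRing.norm_coe_unitary (π.hom g)).le⟩⟩

/-- The full group C⋆-algebra of the discrete group `G`, as a star subalgebra of
`UniversalProduct G`: the closure of the star subalgebra generated by the universal representation,
that is, of the linear span of the operators `universalRep G g`. -/
def groupCStarSubalgebra (G : Type u) [Group G] : StarSubalgebra ℂ (UniversalProduct G) :=
  (StarAlgebra.adjoin ℂ (Set.range (universalRep G))).topologicalClosure

/-- The full group C⋆-algebra `C*(G)` of the discrete group `G`: the completion of the group
algebra `ℂ[G]` (equivalently, of `ℓ¹(G)`) in the universal norm `‖f‖ = sup_π ‖∑ g, f g • π g‖`,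
`π` running through the unitary representations of `G`. It is realised as the closure of the image
of `ℂ[G]` under the universal representation, where the norm of `UniversalProduct G` is the
universal norm. -/
def GroupCStar (G : Type u) [Group G] : Type (u + 1) :=
  groupCStarSubalgebra G

instance (G : Type u) [Group G] : CStarAlgebra (GroupCStar G) :=
  haveI : IsClosed ((groupCStarSubalgebra G : StarSubalgebra ℂ (UniversalProduct G)) :
      Set (UniversalProduct G)) := StarSubalgebra.isClosed_topologicalClosure _
  inferInstanceAs (CStarAlgebra (groupCStarSubalgebra G))

/-- Conjugation by an element of an abelian normal subgroup `N` is trivial on `N`. -/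
theorem conjNormal_of_mem {G : Type u} [Group G] (N : Subgroup G) [N.Normal] [IsMulCommutative N] {g : G} (hg : g ∈ N)
    (a : N) : MulAut.conjNormal g⁻¹ a = a := by
  ext
  have h : g * a = a * g := congrArg Subtype.val (mul_comm' (⟨g, hg⟩ : N) a)
  rw [MulAut.conjNormal_apply, inv_inv, mul_assoc, ← h, inv_mul_cancel_left]

section Dual

variable {G : Type u} [Group G] [TopologicalSpace G] [DiscreteTopology G]

/-- Conjugation by `g` on the dual of a normal subgroup: `(g • χ) a = χ (g⁻¹ * a * g)`. -/
def conjDual (N : Subgroup G) [N.Normal] (g : G) (χ : PontryaginDual N) : PontryaginDual N :=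
  PontryaginDual.map
    ⟨(MulAut.conjNormal g⁻¹ : MulAut N).toMonoidHom, continuous_of_discreteTopology⟩ χ

theorem conjDual_apply (N : Subgroup G) [N.Normal] (g : G) (χ : PontryaginDual N) (a : N) :
    conjDual N g χ a = χ (MulAut.conjNormal g⁻¹ a) := rfl

/-- The action of `G` on the dual of a normal subgroup `N` by conjugation. -/
def conjDualHom (N : Subgroup G) [N.Normal] : G →* Function.End (PontryaginDual N) where
  toFun := conjDual N
  map_one' := by
    funext χ
    refine PontryaginDual.ext fun a => ?_
    rw [conjDual_apply, inv_one, map_one, MulAut.one_apply]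
    rfl
  map_mul' g h := by
    funext χ
    refine PontryaginDual.ext fun a => ?_
    change conjDual N (g * h) χ a = conjDual N g (conjDual N h χ) a
    rw [conjDual_apply, conjDual_apply, conjDual_apply, mul_inv_rev, map_mul, MulAut.mul_apply]

/-- The action of `G ⧸ N` on the dual of an abelian normal subgroup `N` induced by conjugation:
`(gN • χ) a = χ (g⁻¹ * a * g)`. -/
instance quotientActionDual (N : Subgroup G) [N.Normal] [IsMulCommutative N] :
    MulAction (G ⧸ N) (PontryaginDual N) :=
  MulAction.ofEndHom (QuotientGroup.lift N (conjDualHom N) (by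
    intro g hg
    funext χ
    refine PontryaginDual.ext fun a => ?_
    change conjDual N g χ a = χ a
    rw [conjDual_apply, conjNormal_of_mem N hg]))

theorem quotientActionDual_apply (N : Subgroup G) [N.Normal] [IsMulCommutative N] (g : G)
    (χ : PontryaginDual N) (a : N) :
    ((g : G ⧸ N) • χ) a = χ ⟨g⁻¹ * a * g, by
      simpa using (inferInstance : N.Normal).conj_mem a a.2 g⁻¹⟩ := by
  change χ (MulAut.conjNormal g⁻¹ a) = _
  congr 1
  ext
  simp

/-- The orbit space `N̂ / (G ⧸ N)`, with the quotient topology. -/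
abbrev DualOrbitSpace (N : Subgroup G) [N.Normal] [IsMulCommutative N] : Type u :=
  MulAction.orbitRel.Quotient (G ⧸ N) (PontryaginDual N)

end Dual

end

noncomputable section

/-! ### Star algebras generated by a group of unitaries -/

section AdjoinUnitary

variable {K B : Type*} [Group K] [CStarAlgebra B] (v : K →* unitary B)

/-! Write `u_g` for the canonical unitaries of `C*(G)` and `A` for the closed span of the `u_n`, `n
∈ N`. The centre lies in `A`, and `A` is the algebra of continuous functions on the dual of `N`,
where centrality becomes invariance under `G ⧸ N`.

Identification of `A`: it is commutative, and restricting its characters to `N` embeds its spectrum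
in the dual of `N`. Every character `χ` of `N` occurs, because the representation of `G` induced
from `χ` contains a `χ`-eigenvector for `N` (`restrictCharacter_surjective`). Under Gelfand duality,
conjugation by `u_g` becomes the action of `gN` on the dual, so an element of `A` is central in
`C*(G)` exactly when its transform is constant on orbits (`commute_of_iff`).

The centre lies in `A`: compressing `π ⊗ ℓ²(G ⧸ N)`, for all `π` at once, to the matrix entry `(q,
1)` gives a contraction of `C*(G)` that keeps `u_g` for `g` in the coset `q` and kills the other
`u_g`. These maps are `N`-bimodular and sum to the identity. Let `z` be central, `s ∉ N`, and `z_s`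
its part in `sN`. Then `z_s` commutes with `N`, so `a = z_s u_s⁻¹ ∈ A` satisfies `u_m a = u_n a`
with `m = s n s⁻¹`. By maximality some `n` has `m ≠ n`. The transform of `a` vanishes wherever `χ (m
n⁻¹) ≠ 1`, a dense set because `m n⁻¹` has infinite order. Hence `a = 0`, and only the part of `z`
in `N` survives. -/

theorem adjoin_range_unitary_toSubmodule :
    (StarAlgebra.adjoin ℂ (Set.range fun k => (v k : B))).toSubalgebra.toSubmodule =
      Submodule.span ℂ (Set.range fun k => (v k : B)) := by
  -- The unitaries form a group closed under `star`, so the monoid that they generate adds nothing.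
  have h : Submonoid.closure ((Set.range fun k => (v k : B)) ∪ star (Set.range fun k => (v k : B)))
      = MonoidHom.mrange ((unitary B).subtype.comp v) := by
    apply le_antisymm
    · rw [Submonoid.closure_le]
      rintro x (⟨k, rfl⟩ | ⟨k, hk⟩)
      · exact ⟨k, rfl⟩
      · refine ⟨k⁻¹, ?_⟩
        rw [← star_star x, ← hk]
        exact congr_arg Subtype.val (map_inv v k)
    · rintro _ ⟨k, rfl⟩
      exact Submonoid.subset_closure (Or.inl ⟨k, rfl⟩)
  rw [StarAlgebra.adjoin_eq_span, h]
  rfl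

theorem adjoin_range_unitary_induction {p : B → Prop} (hp : IsClosed {x | p x})
    (hv : ∀ k, p (v k)) (hadd : ∀ x y, p x → p y → p (x + y))
    (hsmul : ∀ (c : ℂ) x, p x → p (c • x)) {x : B}
    (hx : x ∈ (StarAlgebra.adjoin ℂ (Set.range fun k => (v k : B))).topologicalClosure) : p x := by
  rw [← SetLike.mem_coe, StarSubalgebra.topologicalClosure_coe] at hx
  refine closure_minimal (fun y hy => ?_) hp hx
  have hy' : y ∈ Submodule.span ℂ (Set.range fun k => (v k : B)) := by
    rw [← adjoin_range_unitary_toSubmodule]; exact hy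
  induction hy' using Submodule.span_induction with
  | mem y h => obtain ⟨k, rfl⟩ := h; exact hv k
  | zero => simpa using hsmul 0 _ (hv 1)
  | add y z _ _ h1 h2 =>
    rename_i h3 h4
    rw [← adjoin_range_unitary_toSubmodule] at h3 h4
    exact hadd y z (h1 h3) (h2 h4)
  | smul c y _ h1 =>
    rename_i h3
    rw [← adjoin_range_unitary_toSubmodule] at h3
    exact hsmul c y (h1 h3)

end AdjoinUnitary

/-! ### The full group C⋆-algebra and its representations -/

section Universal
variable {G : Type u} [Group G]

@[simp] theorem universalRep_apply (g : G) (π : UnitaryRep G) :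
    universalRep G g π = (π.hom g : π.space →L[ℂ] π.space) := rfl

theorem universalRep_mem_unitary (g : G) : universalRep G g ∈ unitary (UniversalProduct G) := by
  rw [Unitary.mem_iff]
  constructor <;> ext π : 2 <;> simp [lp.infty_coeFn_mul]

theorem universalRep_one : universalRep G 1 = 1 := by
  refine lp.ext (funext fun π => ?_)
  simp

theorem universalRep_mul (g h : G) :
    universalRep G (g * h) = universalRep G g * universalRep G h := by
  refine lp.ext (funext fun π => ?_)
  change (π.hom (g * h) : π.space →L[ℂ] π.space) = π.hom g * π.hom h
  simp

/-- The universal representation, as a homomorphism into the unitary group. -/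
def universalUnitary (G : Type u) [Group G] : G →* unitary (UniversalProduct G) where
  toFun g := ⟨universalRep G g, universalRep_mem_unitary g⟩
  map_one' := Subtype.ext universalRep_one
  map_mul' g h := Subtype.ext (universalRep_mul g h)

theorem universalRep_mem (g : G) : universalRep G g ∈ groupCStarSubalgebra G :=
  StarSubalgebra.le_topologicalClosure _ (StarAlgebra.subset_adjoin ℂ _ ⟨g, rfl⟩)

namespace GroupCStar

/-- The inclusion of `C*(G)` into the universal product. -/
def incl (G : Type u) [Group G] : GroupCStar G →⋆ₐ[ℂ] UniversalProduct G :=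
  (groupCStarSubalgebra G).subtype

theorem isometry_incl : Isometry (incl G) := isometry_subtype_coe

theorem incl_mem (x : GroupCStar G) : incl G x ∈ groupCStarSubalgebra G :=
  x.2

/-- The canonical unitary of `C*(G)` attached to a group element. -/
def ofElement (g : G) : GroupCStar G := ⟨universalRep G g, universalRep_mem g⟩

theorem ofElement_mem_unitary (g : G) : ofElement g ∈ unitary (GroupCStar G) := by
  have h := Unitary.mem_iff.1 (universalRep_mem_unitary g)
  rw [Unitary.mem_iff]
  constructor <;> apply (isometry_incl (G := G)).injective
  · rw [map_mul, map_star, map_one]; exact h.1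
  · rw [map_mul, map_star, map_one]; exact h.2

/-- The canonical homomorphism from `G` to the unitary group of `C*(G)`. -/
def of (G : Type u) [Group G] : G →* unitary (GroupCStar G) where
  toFun g := ⟨ofElement g, ofElement_mem_unitary g⟩
  map_one' := Subtype.ext (Subtype.ext universalRep_one)
  map_mul' g h := Subtype.ext (Subtype.ext (universalRep_mul g h))

/-- The inclusion in the universal product is an isometry with complete domain, so it carries closed
sets to closed sets and the density argument can be run in the product. -/
theorem induction {p : GroupCStar G → Prop} (hp : IsClosed {x | p x})
    (hof : ∀ g, p (of G g)) (hadd : ∀ x y, p x → p y → p (x + y))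
    (hsmul : ∀ (c : ℂ) x, p x → p (c • x)) (x : GroupCStar G) : p x := by
  have key : ∀ z ∈ groupCStarSubalgebra G, ∃ y, incl G y = z ∧ p y := by
    intro z hz
    refine adjoin_range_unitary_induction (universalUnitary G)
      (p := fun z => ∃ y, incl G y = z ∧ p y) ?_ ?_ ?_ ?_ hz
    · have : {z | ∃ y, incl G y = z ∧ p y} = incl G '' {x | p x} := by
        ext z; simp [and_comm]
      rw [this]
      exact (isometry_incl (G := G)).isClosedEmbedding.isClosedMap _ hp
    · exact fun g => ⟨_, rfl, hof g⟩
    · rintro _ _ ⟨x, rfl, hx⟩ ⟨y, rfl, hy⟩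
      exact ⟨_, map_add _ _ _, hadd x y hx hy⟩
    · rintro c _ ⟨x, rfl, hx⟩
      exact ⟨_, map_smul _ _ _, hsmul c x hx⟩
  obtain ⟨y, hy, hpy⟩ := key _ (incl_mem x)
  rwa [← (isometry_incl (G := G)).injective hy]

end GroupCStar

/-- The representation of `C*(G)` extending a unitary representation of `G`. -/
def UnitaryRep.toStarAlgHom (π : UnitaryRep G) :
    GroupCStar G →⋆ₐ[ℂ] (π.space →L[ℂ] π.space) where
  toFun x := GroupCStar.incl G x π
  map_one' := by rw [map_one]; rfl
  map_mul' x y := by rw [map_mul]; rfl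
  map_zero' := by rw [map_zero]; rfl
  map_add' x y := by rw [map_add]; rfl
  commutes' c := by rw [AlgHomClass.commutes]; rfl
  map_star' x := by rw [map_star]; rfl

theorem UnitaryRep.toStarAlgHom_of (π : UnitaryRep G) (g : G) :
    π.toStarAlgHom (GroupCStar.of G g) = (π.hom g : π.space →L[ℂ] π.space) := rfl

open scoped CStarAlgebra in
theorem UnitaryRep.continuous_toStarAlgHom (π : UnitaryRep G) : Continuous π.toStarAlgHom :=
  map_continuous π.toStarAlgHom

end Universal

/-! ### Representations on `ℓ²(G ⧸ N, H)` from unitary cocycles -/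

section Monomial

variable {G : Type u} [Group G]

/-- A homomorphism to the isometry group of a Hilbert space, as a unitary representation. -/
def UnitaryRep.ofIsometry {E : Type u} [NormedAddCommGroup E] [InnerProductSpace ℂ E]
    [CompleteSpace E] [Nontrivial E] (ρ : G →* (E ≃ₗᵢ[ℂ] E)) : UnitaryRep G where
  space := E
  hom := Unitary.linearIsometryEquiv.symm.toMonoidHom.comp ρ

variable (N : Subgroup G) [Fintype (G ⧸ N)] {H : Type*} [NormedAddCommGroup H]
  [InnerProductSpace ℂ H]

/-- The representation of `G` on the square integrable functions on `G ⧸ N` with values in `H`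
given by a unitary cocycle `c`. -/
def cocycleRep (c : G → G ⧸ N → (H ≃ₗᵢ[ℂ] H)) (hc : ∀ g h q, c (g * h) q = c g (h • q) * c h q) :
    G →* (PiLp 2 (fun _ : G ⧸ N => H) ≃ₗᵢ[ℂ] PiLp 2 (fun _ : G ⧸ N => H)) :=
  MonoidHom.mk' (fun g => (LinearIsometryEquiv.piLpCongrRight 2 (c g)).trans
      (LinearIsometryEquiv.piLpCongrLeft 2 ℂ H (MulAction.toPerm g))) (by
    intro g h
    ext ξ q
    simp [LinearIsometryEquiv.piLpCongrLeft_apply, hc, mul_smul])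

end Monomial

/-! ### Decomposition of `C*(G)` along the cosets of `N` -/

section CosetPart
variable {G : Type u} [Group G] (N : Subgroup G) [Fintype (G ⧸ N)]

/-- The tensor product of a unitary representation with the permutation representation on
`G ⧸ N`. -/
def UnitaryRep.tensorQuotient (π : UnitaryRep G) : UnitaryRep G :=
  UnitaryRep.ofIsometry (cocycleRep N (fun g _ => Unitary.linearIsometryEquiv (π.hom g))
    (by intros; rw [map_mul, map_mul]))

open scoped Classical in
/-- The embedding of `H` in `H ⊗ ℓ²(G ⧸ N)` as the functions supported at the trivial coset. -/
def UnitaryRep.atOne (π : UnitaryRep G) : π.space →ₗᵢ[ℂ] (π.tensorQuotient N).space where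
  toFun v := (PiLp.single 2 ((1 : G) : G ⧸ N) v : PiLp 2 (fun _ : G ⧸ N => π.space))
  map_add' _ _ := PiLp.single_add ..
  map_smul' c v := congrArg (WithLp.toLp 2)
    (Pi.single_smul (f := fun _ : G ⧸ N => π.space) ((1 : G) : G ⧸ N) c v)
  norm_map' v := PiLp.norm_single 2 (fun _ : G ⧸ N => π.space) ((1 : G) : G ⧸ N) v

/-- Evaluation of the elements of `H ⊗ ℓ²(G ⧸ N)` at a coset. -/
def UnitaryRep.coord (π : UnitaryRep G) (q : G ⧸ N) : (π.tensorQuotient N).space →L[ℂ] π.space :=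
  PiLp.proj (𝕜 := ℂ) 2 (fun _ : G ⧸ N => π.space) q

theorem UnitaryRep.norm_coord_le (π : UnitaryRep G) (q : G ⧸ N) : ‖π.coord N q‖ ≤ 1 :=
  ContinuousLinearMap.opNorm_le_bound _ zero_le_one fun v => by
    rw [one_mul]
    exact PiLp.norm_apply_le (β := fun _ : G ⧸ N => π.space) v q

open scoped Classical in
theorem UnitaryRep.coord_atOne (π : UnitaryRep G) (q : G ⧸ N) (v : π.space) :
    π.coord N q (π.atOne N v) = if q = ((1 : G) : G ⧸ N) then v else 0 := by
  change Pi.single (M := fun _ : G ⧸ N => π.space) ((1 : G) : G ⧸ N) v q = _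
  rw [Pi.single_apply]

theorem UnitaryRep.coord_hom (π : UnitaryRep G) (g : G) (ξ : (π.tensorQuotient N).space)
    (q : G ⧸ N) :
    π.coord N q (((π.tensorQuotient N).hom g :
      (π.tensorQuotient N).space →L[ℂ] (π.tensorQuotient N).space) ξ) =
    (π.hom g : π.space →L[ℂ] π.space) (π.coord N (g⁻¹ • q) ξ) := rfl

/-- The matrix coefficient `(q, 1)` of an operator on `H ⊗ ℓ²(G ⧸ N)`. -/
def UnitaryRep.corner (π : UnitaryRep G) (q : G ⧸ N)
    (T : (π.tensorQuotient N).space →L[ℂ] (π.tensorQuotient N).space) :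
    π.space →L[ℂ] π.space :=
  (π.coord N q).comp (T.comp (π.atOne N).toContinuousLinearMap)

theorem UnitaryRep.norm_corner_le (π : UnitaryRep G) (q : G ⧸ N)
    (T : (π.tensorQuotient N).space →L[ℂ] (π.tensorQuotient N).space) :
    ‖π.corner N q T‖ ≤ ‖T‖ :=
  ContinuousLinearMap.opNorm_le_bound _ (norm_nonneg T) fun v => by
    refine ((π.coord N q).le_of_opNorm_le (π.norm_coord_le N q) _).trans ?_
    rw [one_mul]
    refine (T.le_opNorm _).trans_eq ?_
    exact congrArg (‖T‖ * ·) ((π.atOne N).norm_map v)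

-- The operator of `g` moves a vector supported at the trivial coset to the coset `gN`, so the first
-- column has a single nonzero entry.
open scoped Classical in
theorem UnitaryRep.corner_hom (π : UnitaryRep G) (q : G ⧸ N) (g : G) :
    π.corner N q ((π.tensorQuotient N).hom g :
      (π.tensorQuotient N).space →L[ℂ] (π.tensorQuotient N).space) =
      if (g : G ⧸ N) = q then (π.hom g : π.space →L[ℂ] π.space) else 0 := by
  ext v
  refine (π.coord_hom N g _ q).trans ?_
  refine (congrArg _ (π.coord_atOne N _ v)).trans ?_
  have h : g⁻¹ • q = ((1 : G) : G ⧸ N) ↔ (g : G ⧸ N) = q := by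
    rw [inv_smul_eq_iff, MulAction.Quotient.smul_coe, smul_eq_mul, mul_one, eq_comm]
  simp only [h]
  split_ifs
  · rfl
  · exact map_zero _

namespace GroupCStar

/-- The element of the universal product with components the matrix coefficients `(q, 1)` of
`x` in the representations `π ⊗ ℓ²(G ⧸ N)`. -/
def cosetPartAux (q : G ⧸ N) (x : GroupCStar G) : UniversalProduct G :=
  ⟨fun π => π.corner N q ((π.tensorQuotient N).toStarAlgHom x), memℓp_infty ⟨‖x‖, by
    rintro _ ⟨π, rfl⟩
    exact (π.norm_corner_le N q _).trans
      (NonUnitalStarAlgHom.norm_apply_le (π.tensorQuotient N).toStarAlgHom x)⟩⟩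

theorem cosetPartAux_add (q : G ⧸ N) (x y : GroupCStar G) :
    cosetPartAux N q (x + y) = cosetPartAux N q x + cosetPartAux N q y := by
  refine lp.ext (funext fun π => ?_)
  change π.corner N q ((π.tensorQuotient N).toStarAlgHom (x + y)) =
    π.corner N q ((π.tensorQuotient N).toStarAlgHom x) +
    π.corner N q ((π.tensorQuotient N).toStarAlgHom y)
  rw [map_add]
  rfl

theorem cosetPartAux_smul (q : G ⧸ N) (c : ℂ) (x : GroupCStar G) :
    cosetPartAux N q (c • x) = c • cosetPartAux N q x := by
  refine lp.ext (funext fun π => ?_)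
  change π.corner N q ((π.tensorQuotient N).toStarAlgHom (c • x)) =
    c • π.corner N q ((π.tensorQuotient N).toStarAlgHom x)
  rw [map_smul]
  rfl

theorem norm_cosetPartAux_le (q : G ⧸ N) (x : GroupCStar G) : ‖cosetPartAux N q x‖ ≤ ‖x‖ :=
  lp.norm_le_of_forall_le (norm_nonneg x) fun π => (π.norm_corner_le N q _).trans
      (NonUnitalStarAlgHom.norm_apply_le (π.tensorQuotient N).toStarAlgHom x)

open scoped Classical in
theorem cosetPartAux_of (q : G ⧸ N) (g : G) :
    cosetPartAux N q (of G g) = if (g : G ⧸ N) = q then universalRep G g else 0 := by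
  refine lp.ext (funext fun π => ?_)
  refine (π.corner_hom N q g).trans ?_
  split_ifs <;> rfl

/-- `GroupCStar.cosetPartAux` as a continuous linear map. -/
def cosetPartAuxL (q : G ⧸ N) : GroupCStar G →L[ℂ] UniversalProduct G :=
  LinearMap.mkContinuous (σ := RingHom.id ℂ)
    { toFun := cosetPartAux N q
      map_add' := cosetPartAux_add N q
      map_smul' := cosetPartAux_smul N q } 1
    fun x => by rw [one_mul]; exact norm_cosetPartAux_le N q x

theorem continuous_cosetPartAux (q : G ⧸ N) : Continuous (cosetPartAux N q) :=
  (cosetPartAuxL N q).continuous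

theorem cosetPartAux_mem (q : G ⧸ N) (x : GroupCStar G) :
    cosetPartAux N q x ∈ groupCStarSubalgebra G := by
  classical
  induction x using GroupCStar.induction with
  | hp => exact (StarSubalgebra.isClosed_topologicalClosure _).preimage (continuous_cosetPartAux N q)
  | hof g =>
    rw [cosetPartAux_of]
    split_ifs
    · exact universalRep_mem g
    · exact zero_mem _
  | hadd x y hx hy => rw [cosetPartAux_add]; exact add_mem hx hy
  | hsmul c x hx =>
    rw [cosetPartAux_smul]
    exact (groupCStarSubalgebra G).toSubalgebra.toSubmodule.smul_mem c hx

/-- The contractive projection of `C*(G)` onto the closed span of a coset of `N`. -/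
def cosetPart (q : G ⧸ N) : GroupCStar G →L[ℂ] GroupCStar G :=
  LinearMap.mkContinuous
    { toFun x := ⟨cosetPartAux N q x, cosetPartAux_mem N q x⟩
      map_add' x y := Subtype.ext (cosetPartAux_add N q x y)
      map_smul' c x := Subtype.ext (cosetPartAux_smul N q c x) } 1
    fun x => by rw [one_mul]; exact norm_cosetPartAux_le N q x

open scoped Classical in
theorem cosetPart_of (q : G ⧸ N) (g : G) :
    cosetPart N q (of G g) = if (g : G ⧸ N) = q then (of G g : GroupCStar G) else 0 := by
  refine Subtype.ext ((cosetPartAux_of N q g).trans ?_)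
  split_ifs <;> rfl

theorem sum_cosetPart (x : GroupCStar G) : ∑ q : G ⧸ N, cosetPart N q x = x := by
  classical
  induction x using GroupCStar.induction with
  | hp => exact isClosed_eq (by fun_prop) continuous_id
  | hof g => simp [cosetPart_of]
  | hadd x y hx hy => simp only [map_add, Finset.sum_add_distrib, hx, hy]
  | hsmul c x hx => simp only [map_smul, ← Finset.smul_sum, hx]

theorem cosetPart_mul_of [N.Normal] (q : G ⧸ N) {n : G} (hn : n ∈ N) (x : GroupCStar G) :
    cosetPart N q (x * of G n) = cosetPart N q x * of G n := by
  classical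
  induction x using GroupCStar.induction with
  | hp => exact isClosed_eq (by fun_prop) (by fun_prop)
  | hof g =>
    rw [← Submonoid.coe_mul, ← map_mul, cosetPart_of, cosetPart_of, QuotientGroup.mk_mul_of_mem g hn,
      map_mul]
    split_ifs <;> simp
  | hadd x y hx hy => simp only [map_add, add_mul, hx, hy]
  | hsmul c x hx => simp only [map_smul, smul_mul_assoc, hx]

theorem cosetPart_of_mul [N.Normal] (q : G ⧸ N) {n : G} (hn : n ∈ N) (x : GroupCStar G) :
    cosetPart N q (of G n * x) = of G n * cosetPart N q x := by
  classical
  induction x using GroupCStar.induction with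
  | hp => exact isClosed_eq (by fun_prop) (by fun_prop)
  | hof g =>
    have h : ((n * g : G) : G ⧸ N) = g := by
      rw [QuotientGroup.mk_mul, (QuotientGroup.eq_one_iff n).2 hn, one_mul]
    rw [← Submonoid.coe_mul, ← map_mul, cosetPart_of, cosetPart_of, h, map_mul]
    split_ifs <;> simp
  | hadd x y hx hy => simp only [map_add, mul_add, hx, hy]
  | hsmul c x hx => simp only [map_smul, mul_smul_comm, hx]

end GroupCStar
end CosetPart

/-! ### Density in the Pontryagin dual -/

section Dual

/-- The group `ℝ` is divisible, hence injective, so the map `k • m ↦ k` on the infinite cyclic group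
generated by `m` extends to `A`. -/
theorem exists_addMonoidHom_real_eq_one {A : Type*} [AddCommGroup A] {m : A}
    (hm : ¬ IsOfFinAddOrder m) : ∃ θ : A →+ ℝ, θ m = 1 := by
  let _ : DivisibleBy ℝ ℤ := divisibleByOfSMulRightSurj ℝ ℤ fun {n} hn x =>
    ⟨(n : ℝ)⁻¹ * x, by
      have : (n : ℝ) ≠ 0 := by exact_mod_cast hn
      simp [zsmul_eq_mul, this]⟩
  obtain ⟨θ, hθ⟩ := (Module.Baer.of_divisible ℝ).extension_property_addMonoidHom
    (zmultiplesHom A m) (injective_zsmul_iff_not_isOfFinAddOrder.2 hm) (Int.castAddHom ℝ)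
  exact ⟨θ, by simpa using DFunLike.congr_fun hθ 1⟩

theorem PontryaginDual.continuous_iff {X : Type*} [TopologicalSpace X] {A : Type*} [Monoid A]
    [TopologicalSpace A] [DiscreteTopology A] {f : X → PontryaginDual A} :
    Continuous f ↔ ∀ a, Continuous fun x => f x a := by
  rw [← continuous_pi_iff]
  exact (ContinuousMonoidHom.isClosedEmbedding_coe (A := A) (B := Circle)).continuous_iff

theorem PontryaginDual.continuous_eval {A : Type*} [Monoid A]
    [TopologicalSpace A] [DiscreteTopology A] (a : A) :
    Continuous fun χ : PontryaginDual A => χ a :=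
  PontryaginDual.continuous_iff.1 continuous_id a

/-- A character with `χ m = 1` is a limit of its perturbations `χ · exp(i t θ)` as `t → 0⁺`, where
`θ : A → ℝ` has `θ m = 1`. The perturbed character takes the value `exp(i t) ≠ 1` at `m`. -/
theorem PontryaginDual.dense_setOf_apply_ne_one {A : Type*} [Group A] [IsMulCommutative A]
    [TopologicalSpace A] [DiscreteTopology A] {m : A} (hm : ¬ IsOfFinOrder m) :
    Dense {χ : PontryaginDual A | χ m ≠ 1} := by
  let _ : CommGroup A := { ‹Group A› with mul_comm := mul_comm' }
  obtain ⟨θ, hθ⟩ := exists_addMonoidHom_real_eq_one (A := Additive A) (m := Additive.ofMul m)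
    (by rwa [isOfFinAddOrder_ofMul_iff])
  intro χ
  by_cases hχ : χ m = 1
  swap
  · exact subset_closure hχ
  let ψ : ℝ → PontryaginDual A := fun t =>
    (⟨⟨⟨fun a => χ a * Circle.exp (t * θ (Additive.ofMul a)), by simp⟩, fun a b => by
      simp [mul_add, Circle.exp_add, mul_mul_mul_comm]⟩, continuous_of_discreteTopology⟩ :
      A →ₜ* Circle)
  have hψ (t : ℝ) (a : A) : ψ t a = χ a * Circle.exp (t * θ (Additive.ofMul a)) := rfl
  have hcont : Continuous ψ := PontryaginDual.continuous_iff.2 fun a => by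
    simp only [hψ]; fun_prop
  have h0 : ψ 0 = χ := PontryaginDual.ext fun a => by simp [hψ]
  have hne : ∀ᶠ t in nhdsWithin (0 : ℝ) (Set.Ioi 0), ψ t ∈ {χ : PontryaginDual A | χ m ≠ 1} := by
    filter_upwards [Ioo_mem_nhdsGT Real.pi_pos] with t ht
    rw [hψ, hχ, hθ, mul_one, one_mul]
    intro h
    -- For `0 < t < π` the argument of `exp(i t)` is `t` itself, so `exp(i t) = 1` would force `t =
    -- 0`.
    have h' := Circle.injective_arg.eq_iff.2 h
    rw [Circle.arg_exp (by linarith [ht.1, Real.pi_pos]) ht.2.le] at h'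
    simp at h'
    exact ht.1.ne' h'
  have ht : Filter.Tendsto ψ (nhdsWithin 0 (Set.Ioi 0)) (nhds χ) := by
    rw [← h0]; exact hcont.continuousAt.tendsto.mono_left nhdsWithin_le_nhds
  exact mem_closure_of_tendsto ht hne

end Dual

/-! ### Induction of characters from `N` to `G` -/

section Characters

variable {G : Type u} [Group G] (N : Subgroup G)

theorem quotientCocycle_mem (g : G) (q : G ⧸ N) : (g • q).out⁻¹ * (g * q.out) ∈ N := by
  rw [← QuotientGroup.eq, QuotientGroup.out_eq', ← smul_eq_mul g, ← MulAction.Quotient.smul_coe,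
    QuotientGroup.out_eq']

/-- The cocycle of `G` on `G ⧸ N` with values in `N` given by a choice of representatives. -/
def quotientCocycle (g : G) (q : G ⧸ N) : N :=
  ⟨(g • q).out⁻¹ * (g * q.out), quotientCocycle_mem N g q⟩

theorem quotientCocycle_mul (g h : G) (q : G ⧸ N) :
    quotientCocycle N (g * h) q = quotientCocycle N g (h • q) * quotientCocycle N h q := by
  ext
  simp [quotientCocycle, mul_smul, mul_assoc]

theorem quotientCocycle_one_of_mem [IsMulCommutative N] (n : N) :
    quotientCocycle N n ((1 : G) : G ⧸ N) = n := by
  have h1 : ((n : G) • ((1 : G) : G ⧸ N)) = ((1 : G) : G ⧸ N) := by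
    rw [MulAction.Quotient.smul_coe, smul_eq_mul, mul_one]
    exact QuotientGroup.eq.2 (by simp)
  -- The chosen representative of the trivial coset need not be `1`; it lies in `N`, and
  -- commutativity cancels it.
  have h2 : (((1 : G) : G ⧸ N)).out ∈ N := by
    have := QuotientGroup.eq.1 (QuotientGroup.out_eq' ((1 : G) : G ⧸ N)).symm
    simpa using this
  ext
  change ((n : G) • ((1 : G) : G ⧸ N)).out⁻¹ * (n * (((1 : G) : G ⧸ N)).out) = n
  have h3 : (n : G) * (((1 : G) : G ⧸ N)).out = (((1 : G) : G ⧸ N)).out * n :=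
    congr_arg Subtype.val (mul_comm' n (⟨_, h2⟩ : N))
  rw [h1, h3, inv_mul_cancel_left]

/-- Multiplication by unimodular complex numbers. -/
def circleIsometry : Circle →* (ℂ ≃ₗᵢ[ℂ] ℂ) where
  toFun z := ⟨DistribMulAction.toLinearEquiv ℂ ℂ z, fun v => Circle.norm_smul z v⟩
  map_one' := LinearIsometryEquiv.ext fun v => one_smul Circle v
  map_mul' z w := LinearIsometryEquiv.ext fun v => mul_smul z w v

variable [TopologicalSpace G]

/-- The representation of `G` induced by a character of `N`. -/
def inducedRep [Fintype (G ⧸ N)] (χ : PontryaginDual N) : UnitaryRep G :=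
  UnitaryRep.ofIsometry (cocycleRep N (fun g q => circleIsometry (χ (quotientCocycle N g q)))
    (by intro g h q; rw [quotientCocycle_mul, map_mul, map_mul]))

-- The delta function at the trivial coset works: `N` is normal, so it fixes every coset, and the
-- cocycle of `n` at the trivial coset is `n`.
open scoped Classical in
theorem exists_inducedRep_eigenvector [Fintype (G ⧸ N)] [N.Normal] [IsMulCommutative N]
    (χ : PontryaginDual N) : ∃ e : (inducedRep N χ).space, e ≠ 0 ∧
      ∀ n : N, ((inducedRep N χ).hom (n : G) :
        (inducedRep N χ).space →L[ℂ] (inducedRep N χ).space) e = (χ n : ℂ) • e := by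
  let e : PiLp 2 (fun _ : G ⧸ N => ℂ) := PiLp.single 2 ((1 : G) : G ⧸ N) 1
  refine ⟨e, ?_, fun n => ?_⟩
  · intro h
    have : e ((1 : G) : G ⧸ N) = 0 := by rw [show e = 0 from h]; rfl
    simp [e] at this
  · refine PiLp.ext (α := fun _ : G ⧸ N => ℂ) fun q => ?_
    change (χ (quotientCocycle N n ((n : G)⁻¹ • q)) : ℂ) * e ((n : G)⁻¹ • q) = χ n * e q
    have hq : (n : G)⁻¹ • q = q := by
      obtain ⟨g, rfl⟩ := QuotientGroup.mk_surjective q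
      rw [MulAction.Quotient.smul_coe, smul_eq_mul, QuotientGroup.mk_mul,
        (QuotientGroup.eq_one_iff _).2 (inv_mem n.2), one_mul]
    rw [hq]
    by_cases h : q = ((1 : G) : G ⧸ N)
    · rw [h, quotientCocycle_one_of_mem]
    · have h0 : e q = 0 := PiLp.single_eq_of_ne 2 (β := fun _ : G ⧸ N => ℂ) h 1
      rw [h0, mul_zero, mul_zero]

end Characters

/-! ### Gelfand duality for the subalgebra generated by `N` -/

section AbelianPart

variable {G : Type u} [Group G] (N : Subgroup G)

namespace GroupCStar

/-- The canonical homomorphism from a subgroup to the unitary group of `C*(G)`. -/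
def ofSubgroup : N →* unitary (GroupCStar G) := (of G).comp N.subtype

/-- The C⋆-subalgebra of `C*(G)` generated by a subgroup. -/
def subgroupAlgebra : StarSubalgebra ℂ (GroupCStar G) :=
  (StarAlgebra.adjoin ℂ (Set.range fun n : N => (ofSubgroup N n : GroupCStar G))).topologicalClosure

theorem of_mem_subgroupAlgebra {n : G} (hn : n ∈ N) :
    (of G n : GroupCStar G) ∈ subgroupAlgebra N :=
  StarSubalgebra.le_topologicalClosure _ (StarAlgebra.subset_adjoin ℂ _ ⟨⟨n, hn⟩, rfl⟩)

theorem isClosed_subgroupAlgebra : IsClosed (subgroupAlgebra N : Set (GroupCStar G)) :=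
  StarSubalgebra.isClosed_topologicalClosure _

variable {N}

theorem subgroupAlgebra_induction {p : GroupCStar G → Prop} (hp : IsClosed {x | p x})
    (hof : ∀ n ∈ N, p (of G n)) (hadd : ∀ x y, p x → p y → p (x + y))
    (hsmul : ∀ (c : ℂ) x, p x → p (c • x)) {x : GroupCStar G} (hx : x ∈ subgroupAlgebra N) : p x :=
  adjoin_range_unitary_induction (ofSubgroup N) hp (fun n => hof n n.2) hadd hsmul hx

theorem subgroupAlgebra_mul_comm [IsMulCommutative N] {x y : GroupCStar G}
    (hx : x ∈ subgroupAlgebra N) (hy : y ∈ subgroupAlgebra N) : x * y = y * x := by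
  refine subgroupAlgebra_induction (p := fun x => x * y = y * x)
    (isClosed_eq (by fun_prop) (by fun_prop)) (fun n hn => ?_)
    (fun a b ha hb => by rw [add_mul, mul_add, ha, hb])
    (fun c a ha => by rw [smul_mul_assoc, mul_smul_comm, ha]) hx
  refine subgroupAlgebra_induction (p := fun y => (of G n : GroupCStar G) * y = y * (of G n : GroupCStar G))
    (isClosed_eq (by fun_prop) (by fun_prop)) (fun m hm => ?_)
    (fun a b ha hb => by rw [add_mul, mul_add, ha, hb])
    (fun c a ha => by rw [smul_mul_assoc, mul_smul_comm, ha]) hy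
  rw [← Submonoid.coe_mul, ← Submonoid.coe_mul, ← map_mul, ← map_mul,
    show n * m = m * n from congr_arg Subtype.val (mul_comm' (⟨n, hn⟩ : N) ⟨m, hm⟩)]

variable (N)

/-- The C⋆-subalgebra of `C*(G)` generated by a subgroup, as a type. -/
abbrev SubgroupAlgebra : Type (u + 1) := subgroupAlgebra N

instance : CStarAlgebra (SubgroupAlgebra N) :=
  haveI := isClosed_subgroupAlgebra N
  inferInstance

instance [IsMulCommutative N] : CommCStarAlgebra (SubgroupAlgebra N) where
  mul_comm x y := Subtype.ext (subgroupAlgebra_mul_comm x.2 y.2)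

/-- The canonical unitary of the C⋆-algebra generated by a subgroup. -/
def subgroupOf (n : N) : SubgroupAlgebra N := ⟨of G n, of_mem_subgroupAlgebra N n.2⟩

theorem SubgroupAlgebra.induction {p : SubgroupAlgebra N → Prop} (hp : IsClosed {x | p x})
    (hof : ∀ n, p (subgroupOf N n)) (hadd : ∀ x y, p x → p y → p (x + y))
    (hsmul : ∀ (c : ℂ) x, p x → p (c • x)) (x : SubgroupAlgebra N) : p x := by
  obtain ⟨y, hy, hpy⟩ := subgroupAlgebra_induction
    (p := fun z => ∃ y : SubgroupAlgebra N, (y : GroupCStar G) = z ∧ p y) (by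
      have : {z | ∃ y : SubgroupAlgebra N, (y : GroupCStar G) = z ∧ p y} =
          Subtype.val '' {x | p x} := by
        ext z; simp [and_comm]
      rw [this]
      exact (isClosed_subgroupAlgebra N).isClosedEmbedding_subtypeVal.isClosedMap _ hp)
    (fun n hn => ⟨subgroupOf N ⟨n, hn⟩, rfl, hof _⟩)
    (by
      rintro _ _ ⟨x, rfl, hx⟩ ⟨y, rfl, hy⟩
      exact ⟨x + y, rfl, hadd x y hx hy⟩)
    (by
      rintro c _ ⟨x, rfl, hx⟩
      exact ⟨c • x, rfl, hsmul c x hx⟩) x.2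
  rwa [← Subtype.ext hy]

theorem subgroupOf_one : subgroupOf N 1 = 1 := Subtype.ext (by simp [subgroupOf])

theorem subgroupOf_mul (m n : N) : subgroupOf N (m * n) = subgroupOf N m * subgroupOf N n :=
  Subtype.ext (by simp [subgroupOf])

theorem star_subgroupOf_mul_self (n : N) : star (subgroupOf N n) * subgroupOf N n = 1 :=
  Subtype.ext (Unitary.coe_star_mul_self (of G (n : G)))

open WeakDual

variable [TopologicalSpace G] [DiscreteTopology G] [IsMulCommutative N]

/-- The restriction to `N` of a character of the C⋆-algebra generated by `N`. -/
def restrictCharacter (φ : characterSpace ℂ (SubgroupAlgebra N)) : PontryaginDual N :=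
  (⟨⟨⟨fun n => ⟨φ (subgroupOf N n), mem_sphere_zero_iff_norm.2 (by
      have h := congr_arg φ (star_subgroupOf_mul_self N n)
      rw [map_mul, map_star, map_one, ← starRingEnd_apply, Complex.conj_mul'] at h
      have h' : ‖φ (subgroupOf N n)‖ ^ 2 = 1 := by exact_mod_cast h
      exact (pow_eq_one_iff_of_nonneg (norm_nonneg _) two_ne_zero).1 h')⟩,
    Circle.ext (by
      change φ (subgroupOf N 1) = 1
      rw [subgroupOf_one, map_one])⟩, fun m n => Circle.ext (by
      change φ (subgroupOf N (m * n)) = φ (subgroupOf N m) * φ (subgroupOf N n)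
      rw [subgroupOf_mul, map_mul])⟩, continuous_of_discreteTopology⟩ : N →ₜ* Circle)

theorem restrictCharacter_apply (φ : characterSpace ℂ (SubgroupAlgebra N)) (n : N) :
    (restrictCharacter N φ n : ℂ) = φ (subgroupOf N n) := rfl

theorem continuous_restrictCharacter : Continuous (restrictCharacter N) := by
  refine PontryaginDual.continuous_iff.2 fun n => ?_
  refine Continuous.subtype_mk (f := fun φ : characterSpace ℂ (SubgroupAlgebra N) =>
    φ (subgroupOf N n)) ?_ _
  exact (gelfandTransform ℂ (SubgroupAlgebra N) (subgroupOf N n)).continuous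

theorem restrictCharacter_injective : Function.Injective (restrictCharacter N) := by
  intro φ ψ h
  refine DFunLike.ext _ _ fun x => ?_
  refine SubgroupAlgebra.induction N (p := fun x => φ x = ψ x)
    (isClosed_eq (map_continuous φ) (map_continuous ψ)) (fun n => ?_)
    (fun a b ha hb => by rw [map_add, map_add, ha, hb])
    (fun c a ha => by rw [map_smul, map_smul, ha]) x
  rw [← restrictCharacter_apply, h, restrictCharacter_apply]

/-- The line through the `χ`-eigenvector `e` of the induced representation is stable under the whole
subalgebra, whose eigenvalue on `e` is a character restricting to `χ`. Thus the norm of `C*(G)`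
loses no character of `N`. -/
theorem restrictCharacter_surjective [N.Normal] [Finite (G ⧸ N)] :
    Function.Surjective (restrictCharacter N) := by
  intro χ
  have := Fintype.ofFinite (G ⧸ N)
  obtain ⟨e, he, hχ⟩ := exists_inducedRep_eigenvector N χ
  have key : ∀ x ∈ subgroupAlgebra N,
      (inducedRep N χ).toStarAlgHom x e ∈ Submodule.span ℂ {e} := fun x hx => by
    refine subgroupAlgebra_induction (p := fun x =>
      (inducedRep N χ).toStarAlgHom x e ∈ Submodule.span ℂ {e}) ?_ (fun n hn => ?_)
      (fun a b ha hb => ?_) (fun c a ha => ?_) hx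
    -- A line is closed, so its invariance passes to the closure of the span of `N`.
    · exact (Submodule.closed_of_finiteDimensional _).preimage
        (((inducedRep N χ).continuous_toStarAlgHom).clm_apply continuous_const)
    · rw [UnitaryRep.toStarAlgHom_of, hχ ⟨n, hn⟩]
      exact Submodule.smul_mem _ _ (Submodule.mem_span_singleton_self e)
    · rw [map_add]; exact add_mem ha hb
    · rw [map_smul]; exact Submodule.smul_mem _ c ha
  let Φ := (inducedRep N χ).toStarAlgHom.comp (subgroupAlgebra N).subtype
  have key' : ∀ x : SubgroupAlgebra N, ∃ c : ℂ, Φ x e = c • e := fun x =>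
    (Submodule.mem_span_singleton.1 (key x x.2)).imp fun _ h => h.symm
  choose f hf using key'
  -- Since `e ≠ 0`, eigenvalues are unique; this makes `f` linear and multiplicative.
  have huniq : ∀ a b : ℂ, a • e = b • e → a = b := fun a b h => smul_left_injective ℂ he h
  let F : SubgroupAlgebra N →ₐ[ℂ] ℂ := AlgHom.ofLinearMap
    { toFun := f
      map_add' x y := huniq _ _ (by rw [← hf, add_smul, ← hf, ← hf, map_add]; rfl)
      map_smul' c x := huniq _ _ (by rw [← hf, smul_assoc, ← hf, map_smul]; rfl) }
    (huniq _ _ (by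
      change f 1 • e = _
      rw [← hf, map_one, one_smul]; rfl))
    (fun x y => huniq _ _ (by
      change f (x * y) • e = (f x * f y) • e
      rw [← hf, map_mul]
      change Φ x (Φ y e) = _
      rw [hf y, map_smul, hf x, smul_smul, mul_comm]))
  refine ⟨CharacterSpace.equivAlgHom.symm F, PontryaginDual.ext fun n => Circle.ext ?_⟩
  change f (subgroupOf N n) = χ n
  refine huniq _ _ ?_
  rw [← hf]
  exact hχ n

/-- The spectrum of the C⋆-algebra generated by an abelian normal subgroup of finite index is the
Pontryagin dual of the subgroup. -/
def characterHomeomorph [N.Normal] [Finite (G ⧸ N)] :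
    characterSpace ℂ (SubgroupAlgebra N) ≃ₜ PontryaginDual N :=
  (continuous_restrictCharacter N).homeoOfEquivCompactToT2
    (f := Equiv.ofBijective _ ⟨restrictCharacter_injective N, restrictCharacter_surjective N⟩)

/-- The Gelfand transform of the C⋆-algebra generated by an abelian normal subgroup of finite
index. -/
def gelfandDual [N.Normal] [Finite (G ⧸ N)] : SubgroupAlgebra N ≃⋆ₐ[ℂ] C(PontryaginDual N, ℂ) :=
  (gelfandStarTransform (SubgroupAlgebra N)).trans
    ((characterHomeomorph N).symm.compStarAlgEquiv' ℂ ℂ)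

theorem gelfandDual_subgroupOf [N.Normal] [Finite (G ⧸ N)] (n : N) (χ : PontryaginDual N) :
    gelfandDual N (subgroupOf N n) χ = χ n := by
  obtain ⟨φ, rfl⟩ := (characterHomeomorph N).surjective χ
  change ((characterHomeomorph N).symm (characterHomeomorph N φ)) (subgroupOf N n) = _
  rw [Homeomorph.symm_apply_apply]
  rfl

end GroupCStar
end AbelianPart

/-! ### Maximality of `N` -/

section MaximalAbelian

variable {G : Type u} [Group G] {N : Subgroup G}

/-- If `s` commuted with all of `N`, then `s` and `N` would generate an abelian subgroup strictly
containing `N`. -/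
theorem exists_conj_ne [IsMulCommutative N]
    (hmax : ∀ H : Subgroup G, IsMulCommutative H → N ≤ H → H = N) {s : G} (hs : s ∉ N) :
    ∃ n : N, s * n * s⁻¹ ≠ n := by
  by_contra! h
  have hcomm : ∀ x ∈ insert s (N : Set G), ∀ y ∈ insert s (N : Set G), x * y = y * x := by
    have hsn : ∀ n ∈ N, s * n = n * s := fun n hn => mul_inv_eq_iff_eq_mul.1 (h ⟨n, hn⟩)
    rintro x (rfl | hx) y (rfl | hy)
    · rfl
    · exact hsn y hy
    · exact (hsn x hx).symm
    · exact congrArg Subtype.val (mul_comm' (⟨x, hx⟩ : N) ⟨y, hy⟩)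
  have hH := hmax (Subgroup.closure (insert s (N : Set G)))
    (Subgroup.isMulCommutative_closure hcomm)
    fun n hn => Subgroup.subset_closure (Or.inr hn)
  exact hs (hH ▸ Subgroup.subset_closure (Or.inl rfl))

end MaximalAbelian

/-! ### The centre of `C*(G)` -/

section Centre

variable {G : Type u} [Group G] (N : Subgroup G)

namespace GroupCStar

theorem cosetPart_mul_of_inv_mem [Fintype (G ⧸ N)] [N.Normal] (s : G) (x : GroupCStar G) :
    cosetPart N s x * (of G s⁻¹ : GroupCStar G) ∈ subgroupAlgebra N := by
  classical
  induction x using GroupCStar.induction with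
  | hp => exact (isClosed_subgroupAlgebra N).preimage (by fun_prop)
  | hof g =>
    rw [cosetPart_of]
    split_ifs with h
    · rw [← Submonoid.coe_mul, ← map_mul]
      refine of_mem_subgroupAlgebra N ?_
      rw [← QuotientGroup.eq_one_iff, QuotientGroup.mk_mul, QuotientGroup.mk_inv, h, mul_inv_cancel]
    · rw [zero_mul]; exact zero_mem _
  | hadd x y hx hy => rw [map_add, add_mul]; exact add_mem hx hy
  | hsmul c x hx =>
    rw [map_smul, smul_mul_assoc]
    exact (subgroupAlgebra N).toSubalgebra.toSubmodule.smul_mem c hx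

theorem mem_center_of_commute_of {x : GroupCStar G}
    (h : ∀ g, (of G g : GroupCStar G) * x = x * (of G g : GroupCStar G)) :
    x ∈ NonUnitalStarSubalgebra.center ℂ (GroupCStar G) := by
  rw [NonUnitalStarSubalgebra.mem_center_iff]
  intro y
  induction y using GroupCStar.induction with
  | hp => exact isClosed_eq (by fun_prop) (by fun_prop)
  | hof g => exact h g
  | hadd a b ha hb => rw [add_mul, mul_add, ha, hb]
  | hsmul c a ha => rw [smul_mul_assoc, mul_smul_comm, ha]

variable [TopologicalSpace G] [DiscreteTopology G] [N.Normal] [IsMulCommutative N]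

theorem continuous_smul_dual (q : G ⧸ N) : Continuous fun χ : PontryaginDual N => q • χ := by
  obtain ⟨g, rfl⟩ := QuotientGroup.mk_surjective q
  refine PontryaginDual.continuous_iff.2 fun n => ?_
  simp only [quotientActionDual_apply]
  exact PontryaginDual.continuous_eval _

variable [Finite (G ⧸ N)]

/-- The endomorphism of the C⋆-algebra generated by `N` given by the action on the dual. -/
def twist (q : G ⧸ N) : SubgroupAlgebra N →⋆ₐ[ℂ] SubgroupAlgebra N :=
  ((gelfandDual N).symm : C(PontryaginDual N, ℂ) →⋆ₐ[ℂ] SubgroupAlgebra N).comp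
    ((ContinuousMap.compStarAlgHom' ℂ ℂ ⟨_, continuous_smul_dual N q⟩).comp
      (gelfandDual N : SubgroupAlgebra N →⋆ₐ[ℂ] C(PontryaginDual N, ℂ)))

theorem gelfandDual_twist (q : G ⧸ N) (a : SubgroupAlgebra N) (χ : PontryaginDual N) :
    gelfandDual N (twist N q a) χ = gelfandDual N a (q • χ) := by
  change gelfandDual N ((gelfandDual N).symm _) χ = _
  rw [StarAlgEquiv.apply_symm_apply]
  rfl

open scoped CStarAlgebra in
theorem continuous_twist (q : G ⧸ N) : Continuous (twist N q) := map_continuous (twist N q)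

theorem twist_subgroupOf (g : G) (n : N) : twist N g (subgroupOf N n) =
    subgroupOf N ⟨g⁻¹ * n * g, by
      simpa using (inferInstance : N.Normal).conj_mem n n.2 g⁻¹⟩ := by
  apply EquivLike.injective (gelfandDual N)
  ext χ
  rw [gelfandDual_twist, gelfandDual_subgroupOf, gelfandDual_subgroupOf, quotientActionDual_apply]

/-- This identifies `twist`, defined through the action on the dual, with conjugation by the unitary
of `g`; on the generators it reads `n g = g (g⁻¹ n g)`. -/
theorem mul_of_eq_of_mul_twist (g : G) (a : SubgroupAlgebra N) :
    (a : GroupCStar G) * (of G g : GroupCStar G) = (of G g : GroupCStar G) * twist N g a := by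
  induction a using SubgroupAlgebra.induction with
  | hp =>
    exact isClosed_eq (by fun_prop)
      (continuous_const.mul (continuous_subtype_val.comp (continuous_twist N g)))
  | hof n =>
    rw [twist_subgroupOf]
    change (of G (n : G) : GroupCStar G) * (of G g : GroupCStar G) =
      (of G g : GroupCStar G) * (of G (g⁻¹ * n * g) : GroupCStar G)
    rw [← Submonoid.coe_mul, ← Submonoid.coe_mul, ← map_mul, ← map_mul]
    simp [mul_assoc]
  | hadd a b ha hb =>
    rw [map_add]
    change ((a : GroupCStar G) + b) * (of G g : GroupCStar G) =
      (of G g : GroupCStar G) * ((twist N g a : GroupCStar G) + twist N g b)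
    rw [add_mul, mul_add, ha, hb]
  | hsmul c a ha =>
    rw [map_smul]
    change (c • (a : GroupCStar G)) * (of G g : GroupCStar G) =
      (of G g : GroupCStar G) * (c • (twist N g a : GroupCStar G))
    rw [smul_mul_assoc, mul_smul_comm, ha]

theorem commute_of_iff (g : G) (a : SubgroupAlgebra N) :
    (of G g : GroupCStar G) * a = a * (of G g : GroupCStar G) ↔
      ∀ χ, gelfandDual N a ((g : G ⧸ N) • χ) = gelfandDual N a χ := by
  have h : (of G g : GroupCStar G) * a = (of G g : GroupCStar G) * twist N g a ↔
      (a : GroupCStar G) = twist N g a := by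
    refine ⟨fun h => ?_, fun h => congrArg _ h⟩
    have := congrArg (star (of G g : GroupCStar G) * ·) h
    simpa only [← mul_assoc, Unitary.coe_star_mul_self, one_mul] using this
  rw [mul_of_eq_of_mul_twist, h]
  constructor
  · intro h χ
    rw [← gelfandDual_twist, ← Subtype.ext h]
  · intro h
    refine congrArg Subtype.val ((EquivLike.injective (gelfandDual N)) (ContinuousMap.ext fun χ => ?_))
    rw [gelfandDual_twist, h]

variable {N}

/-- The hypothesis gives `χ m · â χ = χ n · â χ` for the Gelfand transform `â`, so `â` vanishes on
the dense set where `χ (m n⁻¹) ≠ 1`, hence everywhere. -/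
theorem eq_zero_of_subgroupOf_mul_eq {m n : N} (hmn : ¬ IsOfFinOrder (m * n⁻¹))
    {a : SubgroupAlgebra N} (h : subgroupOf N m * a = subgroupOf N n * a) : a = 0 := by
  apply EquivLike.injective (gelfandDual N)
  rw [map_zero]
  refine ContinuousMap.coe_injective ?_
  refine Continuous.ext_on (PontryaginDual.dense_setOf_apply_ne_one hmn) (map_continuous _)
    continuous_const fun χ hχ => ?_
  have h' := congrArg (fun b => gelfandDual N b χ) h
  simp only [map_mul, ContinuousMap.mul_apply, gelfandDual_subgroupOf] at h'
  by_contra h0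
  have h1 := Circle.ext (mul_right_cancel₀ h0 h')
  exact hχ (by rw [map_mul, h1, ← map_mul, mul_inv_cancel, map_one])

theorem mem_subgroupAlgebra_of_mem_center
    (hmax : ∀ H : Subgroup G, IsMulCommutative H → N ≤ H → H = N)
    (htf : ∀ n : N, IsOfFinOrder n → n = 1) {z : GroupCStar G}
    (hz : z ∈ NonUnitalStarSubalgebra.center ℂ (GroupCStar G)) : z ∈ subgroupAlgebra N := by
  have := Fintype.ofFinite (G ⧸ N)
  rw [NonUnitalStarSubalgebra.mem_center_iff] at hz
  have hmem : ∀ s : G, s ∉ N → cosetPart N s z = 0 := by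
    intro s hs
    obtain ⟨n, hn⟩ := exists_conj_ne hmax hs
    -- The projection onto a coset commutes with left and right multiplication by `N`, so it
    -- preserves commutation with `n`.
    have hcomm : (of G (n : G) : GroupCStar G) * cosetPart N s z =
        cosetPart N s z * (of G (n : G) : GroupCStar G) := by
      rw [← cosetPart_of_mul N _ n.2, ← cosetPart_mul_of N _ n.2, hz]
    let a : SubgroupAlgebra N := ⟨_, cosetPart_mul_of_inv_mem N s z⟩
    have hcz : cosetPart N s z = a * (of G s : GroupCStar G) := by
      change _ = cosetPart N s z * (of G s⁻¹ : GroupCStar G) * (of G s : GroupCStar G)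
      rw [mul_assoc, ← Submonoid.coe_mul, ← map_mul, inv_mul_cancel, map_one, Submonoid.coe_one,
        mul_one]
    let m : N := ⟨s * n * s⁻¹, (inferInstance : N.Normal).conj_mem n n.2 s⟩
    have ha : a = 0 := by
      refine eq_zero_of_subgroupOf_mul_eq (m := m) (n := n) (fun h => hn ?_) ?_
      · exact congrArg Subtype.val (mul_inv_eq_one.1 (htf _ h))
      -- With `a = z_s s⁻¹`, moving `m` to the right of `a` in the commutative subalgebra gives `a
      -- (s n s⁻¹) = z_s n s⁻¹ = n z_s s⁻¹ = n a`.
      · rw [mul_comm]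
        refine Subtype.ext ?_
        change cosetPart N s z * (of G s⁻¹ : GroupCStar G) * (of G (s * n * s⁻¹) : GroupCStar G) =
          (of G (n : G) : GroupCStar G) * (cosetPart N s z * (of G s⁻¹ : GroupCStar G))
        rw [← mul_assoc, hcomm, mul_assoc, mul_assoc, ← Submonoid.coe_mul, ← map_mul,
          inv_mul_cancel_left, map_mul, Submonoid.coe_mul, ← mul_assoc]
    rw [hcz, ha]
    exact zero_mul _
  have h1 : cosetPart N ((1 : G) : G ⧸ N) z = z := by
    refine Eq.trans ?_ (sum_cosetPart N z)
    refine (Finset.sum_eq_single (f := fun q => cosetPart N q z) ((1 : G) : G ⧸ N) (fun q _ hq => ?_)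
      fun h => absurd (Finset.mem_univ _) h).symm
    obtain ⟨s, rfl⟩ := QuotientGroup.mk_surjective q
    exact hmem s fun hs => hq ((QuotientGroup.eq_one_iff s).2 hs)
  have h2 := cosetPart_mul_of_inv_mem N 1 z
  rwa [h1, inv_one, map_one, Submonoid.coe_one, mul_one] at h2

variable (N)

/-- The embedding of the continuous functions on the orbit space of the dual of `N` in `C*(G)`. -/
def orbitFunctions : C(DualOrbitSpace N, ℂ) →⋆ₐ[ℂ] GroupCStar G :=
  (subgroupAlgebra N).subtype.comp
    (((gelfandDual N).symm : C(PontryaginDual N, ℂ) →⋆ₐ[ℂ] SubgroupAlgebra N).comp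
      (ContinuousMap.compStarAlgHom' ℂ ℂ ⟨Quotient.mk _, continuous_quotient_mk'⟩))

theorem orbitFunctions_injective : Function.Injective (orbitFunctions N) := by
  intro f g h
  have h' := ContinuousMap.congr_fun (EquivLike.injective (gelfandDual N).symm (Subtype.ext h))
  ext x
  obtain ⟨χ, rfl⟩ := Quotient.mk_surjective x
  exact h' χ

theorem orbitFunctions_mem_center (f : C(DualOrbitSpace N, ℂ)) :
    orbitFunctions N f ∈ NonUnitalStarSubalgebra.center ℂ (GroupCStar G) := by
  refine mem_center_of_commute_of fun g => (commute_of_iff N g ((gelfandDual N).symm _)).2 fun χ => ?_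
  rw [StarAlgEquiv.apply_symm_apply]
  exact congrArg f (Quotient.sound ⟨(g : G ⧸ N), rfl⟩)

/-- Commuting with the unitaries of `G` makes the Gelfand transform of `a` constant on orbits, so it
descends to a continuous function on the quotient. -/
theorem exists_orbitFunctions_eq {a : SubgroupAlgebra N}
    (ha : (a : GroupCStar G) ∈ NonUnitalStarSubalgebra.center ℂ (GroupCStar G)) :
    ∃ f, orbitFunctions N f = a := by
  rw [NonUnitalStarSubalgebra.mem_center_iff] at ha
  let f : C(DualOrbitSpace N, ℂ) := ⟨Quotient.lift (gelfandDual N a) (by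
    rintro _ χ ⟨q, rfl⟩
    obtain ⟨g, rfl⟩ := QuotientGroup.mk_surjective q
    exact (commute_of_iff N g a).1 (ha _) χ), (map_continuous (gelfandDual N a)).quotient_lift _⟩
  refine ⟨f, congrArg Subtype.val (?_ : (gelfandDual N).symm _ = a)⟩
  rw [← (gelfandDual N).symm_apply_apply a]
  rfl

end GroupCStar
end Centre

end

theorem proposition5p4 {G : Type u} [Group G] [TopologicalSpace G] [DiscreteTopology G]
    (N : Subgroup G) [N.Normal] [IsMulCommutative N]
    (hmax : ∀ H : Subgroup G, IsMulCommutative H → N ≤ H → H = N)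
    (htf : ∀ n : N, IsOfFinOrder n → n = 1)
    [Finite (G ⧸ N)] :
    Nonempty (NonUnitalStarSubalgebra.center ℂ (GroupCStar G) ≃⋆ₐ[ℂ] C(DualOrbitSpace N, ℂ)) := by
  refine ⟨(StarAlgEquiv.ofBijective (NonUnitalStarAlgHom.codRestrict (GroupCStar.orbitFunctions N)
    _ (GroupCStar.orbitFunctions_mem_center N)) ⟨?_, fun z => ?_⟩).symm⟩
  · exact (NonUnitalStarAlgHom.injective_codRestrict _ _ _).2
      (GroupCStar.orbitFunctions_injective N)
  · obtain ⟨f, hf⟩ := GroupCStar.exists_orbitFunctions_eq N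
      (a := ⟨z, GroupCStar.mem_subgroupAlgebra_of_mem_center hmax htf z.2⟩) z.2
    exact ⟨f, Subtype.ext hf⟩
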